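/- Let $d\ge 1$, let $\Sigma=\{x\in\mathbb{R}^d: 0\le x_i\le 1,\ \sum_{j=1}^d x_j\le 1\}$, and let $\mathcal{C}$ be the set of all compact convex sets $C\subset\mathbb{R}^d$ such that $\epsilon\Sigma\subset C\subset\delta\Sigma$ for some $\delta>\epsilon>0$ (which may depend on $C$), equipped with the Hausdorff metric. Let $K\subset\mathbb{C}^d$ be compact. For $C\in\mathcal{C}$ and $n\ge 1$ let $\alpha(1),\dots,\alpha(d_n)$ be an enumeration of the finite set $nC\cap\mathbb{N}^d$ (where $0\in\mathbb{N}$), let $l_n=\sum_{j=1}^{d_n}\left(\alpha_1(j)+\dots+\alpha_d(j)\right)$, and let $$V_n=\max_{\zeta_1,\dots,\zeta_{d_n}\in K}\left|\det\left[\zeta_j^{\alpha(i)}\right]_{i,j=1,\dots,d_n}\right|,\qquad z^{\alpha}=z_1^{\alpha_1}\cdots z_d^{\alpha_d}$$ (with $V_n=0$ if $K=\emptyset$). The $C$-transfinite diameter of $K$ is $\delta_C(K)=\limsup_{n\to\infty}V_n^{1/l_n}$. Then $\delta_C(K)<\infty$ for every $C\in\mathcal{C}$, and the map $\mathcal{C}\to[0,\infty)$,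 $C\mapsto\delta_C(K)$, is continuous. -/

import Mathlib

open Filter Topology
open scoped ENNReal Pointwise

noncomputable section

namespace CTransfinite

/-- The standard unit simplex `Σ = {x ∈ ℝ^d : 0 ≤ x_i ≤ 1, ∑ x_j ≤ 1}`. -/
def unitSimplex (d : ℕ) : Set (EuclideanSpace ℝ (Fin d)) :=
  {x | (∀ i, 0 ≤ x i ∧ x i ≤ 1) ∧ ∑ j, x j ≤ 1}

/-- The convex bodies `C` with `εΣ ⊆ C ⊆ δΣ` for some `δ > ε > 0` (depending on `C`).
As a subtype of `ConvexBody (EuclideanSpace ℝ (Fin d))` (nonempty compact convex sets) it carries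
the Hausdorff metric. -/
abbrev AdmissibleBody (d : ℕ) : Type :=
  {C : ConvexBody (EuclideanSpace ℝ (Fin d)) //
    ∃ ε δ : ℝ, 0 < ε ∧ ε < δ ∧
      ε • unitSimplex d ⊆ (C : Set (EuclideanSpace ℝ (Fin d))) ∧
      (C : Set (EuclideanSpace ℝ (Fin d))) ⊆ δ • unitSimplex d}

variable {d : ℕ}

/-- A multi-index `α ∈ ℕ^d` viewed as a point of `ℝ^d`. -/
def toPoint (α : Fin d → ℕ) : EuclideanSpace ℝ (Fin d) :=
  WithLp.toLp 2 fun i => (α i : ℝ)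

theorem finite_exponents (C : ConvexBody (EuclideanSpace ℝ (Fin d))) (n : ℕ) :
    {α : Fin d → ℕ |
      toPoint α ∈ (n : ℝ) • (C : Set (EuclideanSpace ℝ (Fin d)))}.Finite := by
  obtain ⟨r, hr⟩ := (C.isBounded.smul₀ (n : ℝ)).exists_norm_le
  refine (Set.finite_Iic (fun _ : Fin d => ⌊r⌋₊)).subset ?_
  intro α hα i
  have h1 : ‖toPoint α i‖ ≤ r := (PiLp.norm_apply_le (toPoint α) i).trans (hr _ hα)
  have h2 : ((α i : ℕ) : ℝ) ≤ r := by simpa [toPoint] using h1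
  exact Nat.le_floor h2

/-- The finite set `nC ∩ ℕ^d` of exponents of the monomials spanning `Poly(nC)`;
its cardinality is `d_n = dim Poly(nC)`. -/
def exponents (C : ConvexBody (EuclideanSpace ℝ (Fin d))) (n : ℕ) : Finset (Fin d → ℕ) :=
  (finite_exponents C n).toFinset

/-- The monomial `z^α = z_1^{α_1} ⋯ z_d^{α_d}`. -/
def monom (α : Fin d → ℕ) (z : Fin d → ℂ) : ℂ := ∏ i, z i ^ α i

/-- The Vandermonde determinant `det [e_i(ζ_j)]` of the monomials `e_i` of `Poly(nC)` at `d_n`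
points. Rows and points are indexed by the exponents themselves instead of by `1, …, d_n`; a choice
of order would only affect the sign. -/
def vandermonde (C : ConvexBody (EuclideanSpace ℝ (Fin d))) (n : ℕ)
    (ζ : exponents C n → Fin d → ℂ) : ℂ :=
  (Matrix.of fun α β : exponents C n => monom (α : Fin d → ℕ) (ζ β)).det

/-- `V_n(K)`, the maximum of `|VDM(ζ_1, …, ζ_{d_n})|` over points of `K`, as an extended
nonnegative real. -/
def maxVandermonde (C : ConvexBody (EuclideanSpace ℝ (Fin d))) (K : Set (Fin d → ℂ))
    (n : ℕ) : ℝ≥0∞ :=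
  ⨆ (ζ : exponents C n → Fin d → ℂ) (_ : ∀ β, ζ β ∈ K), ‖vandermonde C n ζ‖ₑ

/-- `l_n`, the sum of the (total) degrees of the monomials of `Poly(nC)`. -/
def sumDegrees (C : ConvexBody (EuclideanSpace ℝ (Fin d))) (n : ℕ) : ℕ :=
  ∑ α ∈ exponents C n, ∑ i, α i

/-- The `C`-transfinite diameter `δ_C(K) = limsup_{n → ∞} V_n^{1 / l_n}`. -/
def transfiniteDiameter (C : ConvexBody (EuclideanSpace ℝ (Fin d)))
    (K : Set (Fin d → ℂ)) : ℝ≥0∞ :=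
  limsup (fun n : ℕ => maxVandermonde C K n ^ (1 / (sumDegrees C n : ℝ))) atTop

end CTransfinite

end

/-!
The transfinite diameter depends on the body `C` only up to small errors, because the Vandermonde
maxima of two nearby bodies can be compared in both directions.

Let `M ≥ 1` bound the coordinates of the points of `K`. Laplace expansion shows that adjoining a
monomial of degree `k` to a Vandermonde determinant multiplies its maximum by at most the new size
times `M ^ k`, and translating all exponents by an integer vector `w` only multiplies the
determinant by values of the monomial `z ^ w`. So if a translate of the exponents of `mA` lies
among those of `nB`, then
`V_n(B) * M ^ l_m(A) ≤ d_n(B)! * M ^ l_n(B) * V_m(A)` (`maxVandermonde_mul_pow_le`).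
As `d_n! ^ (1 / l_n) → 1`, taking roots gives `δ_B ≤ M ^ (1 - ρ) * δ_A ^ ρ` as soon as
`l_m(A) / l_n(B) ≥ ρ` along `m = ⌊t * n⌋` (`transfiniteDiameter_le_weightedMean`).

For `t < 1` and `C` close to `C₀` in the Hausdorff metric, suitable translates exist from `C₀` to
`C` and back (`eventually_absorbs`). The translation is essential: the bodies have the origin on
their boundary, so `t • C₀ ⊆ C` may fail for `C` arbitrarily close to `C₀`. Composing the two
comparisons bounds the degree ratios by ratios `l_m(C₀) / l_n(C₀)` for the fixed body, and these
are governed by `l_n(C₀) ~ n ^ (d + 1) * ∫_{C₀} (x_1 + ⋯ + x_d) dx`. Letting `t → 1`, hence `ρ → 1`,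
yields continuity. Neither regularity of `K` nor convergence of `V_n ^ (1 / l_n)` is needed.
-/

noncomputable section

/-! ### Vandermonde maxima of families of monomials -/

namespace CTransfinite

open scoped NNReal

variable {d : ℕ} {K : Set (Fin d → ℂ)} {M : ℝ≥0}

/-- The maximal modulus over `K` of the Vandermonde determinant of the monomials `z ^ a i`, for an
arbitrary finite family `a` of exponents. -/
def maxDet {ι : Type*} [Fintype ι] [DecidableEq ι] (K : Set (Fin d → ℂ)) (a : ι → Fin d → ℕ) :
    ℝ≥0∞ :=
  ⨆ (ζ : ι → Fin d → ℂ) (_ : ∀ β, ζ β ∈ K),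
    ‖(Matrix.of fun α β => monom (a α) (ζ β)).det‖ₑ

theorem enorm_monom_le (hM : ∀ z ∈ K, ∀ i, ‖z i‖ₑ ≤ M) {z : Fin d → ℂ} (hz : z ∈ K)
    (α : Fin d → ℕ) : ‖monom α z‖ₑ ≤ (M : ℝ≥0∞) ^ ∑ i, α i := by
  have h : ‖monom α z‖ₑ = ∏ i, ‖z i‖ₑ ^ α i := by
    simp only [monom, enorm_eq_nnnorm, nnnorm_prod, nnnorm_pow,
      ENNReal.ofNNReal_finsetProd, ENNReal.coe_pow]
  rw [h, ← Finset.prod_pow_eq_pow_sum]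
  exact Finset.prod_le_prod' fun i _ => pow_le_pow_left' (hM z hz i) _

theorem maxDet_comp_equiv_le {ι κ : Type*} [Fintype ι] [DecidableEq ι] [Fintype κ] [DecidableEq κ]
    (e : ι ≃ κ) (a : κ → Fin d → ℕ) : maxDet K a ≤ maxDet K (a ∘ e) := by
  refine iSup₂_le fun ζ hζ => ?_
  refine le_trans (le_of_eq ?_) (le_iSup₂ (ζ ∘ e) fun β => hζ (e β))
  rw [← Matrix.det_submatrix_equiv_self e]
  rfl

theorem maxDet_comp_equiv {ι κ : Type*} [Fintype ι] [DecidableEq ι] [Fintype κ] [DecidableEq κ]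
    (e : ι ≃ κ) (a : κ → Fin d → ℕ) : maxDet K (a ∘ e) = maxDet K a := by
  refine le_antisymm ?_ (maxDet_comp_equiv_le e a)
  have := maxDet_comp_equiv_le (K := K) e.symm (a ∘ e)
  rwa [Function.comp_assoc, e.self_comp_symm, Function.comp_id] at this

/-- Laplace expansion along the first row: adjoining one monomial of degree `k` to `n` others costs
a factor `(n + 1) * M ^ k`. -/
theorem maxDet_succ_le (hM : ∀ z ∈ K, ∀ i, ‖z i‖ₑ ≤ M) {n : ℕ} (a : Fin (n + 1) → Fin d → ℕ) :
    maxDet K a ≤ (n + 1 : ℕ) * (M : ℝ≥0∞) ^ (∑ i, a 0 i) * maxDet K (fun j => a (Fin.succ j)) := by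
  refine iSup₂_le fun ζ hζ => ?_
  rw [Matrix.det_succ_row_zero]
  refine (enorm_sum_le _ _).trans ?_
  have key : ∀ j ∈ (Finset.univ : Finset (Fin (n + 1))),
      ‖(-1 : ℂ) ^ (j : ℕ) * (Matrix.of fun α β => monom (a α) (ζ β)) 0 j *
        ((Matrix.of fun α β => monom (a α) (ζ β)).submatrix Fin.succ j.succAbove).det‖ₑ ≤
      (M : ℝ≥0∞) ^ (∑ i, a 0 i) * maxDet K (fun j => a (Fin.succ j)) := by
    intro j _
    rw [enorm_mul, enorm_mul, enorm_pow, enorm_neg, enorm_one, one_pow, one_mul]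
    refine mul_le_mul' (enorm_monom_le hM (hζ j) _) ?_
    exact le_iSup₂ (f := fun (ξ : Fin n → Fin d → ℂ) (_ : ∀ β, ξ β ∈ K) =>
      ‖(Matrix.of fun α β => monom (a (Fin.succ α)) (ξ β)).det‖ₑ)
      (fun β => ζ (j.succAbove β)) fun β => hζ _
  refine (Finset.sum_le_sum key).trans ?_
  rw [Finset.sum_const, Finset.card_univ, Fintype.card_fin, nsmul_eq_mul, mul_assoc]

/-- `maxDet` of the monomials with exponents in a finite set. -/
def finsetDet (K : Set (Fin d → ℂ)) (S : Finset (Fin d → ℕ)) : ℝ≥0∞ :=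
  maxDet K (Subtype.val : S → Fin d → ℕ)

theorem maxVandermonde_eq (C : ConvexBody (EuclideanSpace ℝ (Fin d))) (n : ℕ) :
    maxVandermonde C K n = finsetDet K (exponents C n) := rfl

theorem finsetDet_insert_le (hM : ∀ z ∈ K, ∀ i, ‖z i‖ₑ ≤ M) {S : Finset (Fin d → ℕ)}
    {α : Fin d → ℕ} (hα : α ∉ S) :
    finsetDet K (insert α S) ≤
      (S.card + 1 : ℕ) * (M : ℝ≥0∞) ^ (∑ i, α i) * finsetDet K S := by
  let e : Fin (S.card + 1) ≃ (insert α S : Finset (Fin d → ℕ)) :=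
    (finSuccEquiv S.card).trans
      ((Equiv.optionCongr S.equivFin.symm).trans (Finset.subtypeInsertEquivOption hα).symm)
  have h0 : ((e 0 : _) : Fin d → ℕ) = α := rfl
  have hs : (fun j : Fin S.card => ((e j.succ : _) : Fin d → ℕ)) =
      (Subtype.val : S → Fin d → ℕ) ∘ S.equivFin.symm := by
    funext j
    rfl
  have h := maxDet_succ_le hM (fun j => ((e j : _) : Fin d → ℕ))
  rw [hs, h0, maxDet_comp_equiv] at h
  refine le_trans (le_of_eq ?_) h
  exact (maxDet_comp_equiv e _).symm

theorem finsetDet_union_le (hM : ∀ z ∈ K, ∀ i, ‖z i‖ₑ ≤ M) (S U : Finset (Fin d → ℕ))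
    (hSU : Disjoint S U) :
    finsetDet K (S ∪ U) ≤
      ((S ∪ U).card.factorial : ℕ) * (M : ℝ≥0∞) ^ (∑ α ∈ U, ∑ i, α i) * finsetDet K S := by
  induction U using Finset.induction_on with
  | empty =>
    simp only [Finset.union_empty, Finset.sum_empty, pow_zero, mul_one]
    refine le_mul_of_one_le_left' ?_
    exact_mod_cast Nat.succ_le_of_lt (Nat.factorial_pos _)
  | insert α U hα ih =>
    rw [Finset.disjoint_insert_right] at hSU
    have hn : α ∉ S ∪ U := by simp [hα, hSU.1]
    rw [Finset.union_insert]
    refine (finsetDet_insert_le hM hn).trans ((mul_le_mul_right (ih hSU.2) _).trans (le_of_eq ?_))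
    rw [Finset.card_insert_of_notMem hn, Finset.sum_insert hα, Nat.factorial_succ, pow_add,
      Nat.cast_mul]
    ring

theorem finsetDet_le_of_subset (hM : ∀ z ∈ K, ∀ i, ‖z i‖ₑ ≤ M) {S T : Finset (Fin d → ℕ)}
    (hST : S ⊆ T) :
    finsetDet K T ≤
      (T.card.factorial : ℕ) * (M : ℝ≥0∞) ^ (∑ α ∈ T \ S, ∑ i, α i) * finsetDet K S := by
  have h := finsetDet_union_le hM S (T \ S) Finset.disjoint_sdiff
  rwa [Finset.union_sdiff_of_subset hST] at h

theorem finsetDet_empty_le : finsetDet K ∅ ≤ 1 := by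
  refine iSup₂_le fun ζ _ => ?_
  rw [Matrix.det_isEmpty, enorm_one]

/-- Translating all exponents by `w` multiplies the Vandermonde determinant by the values of the
single monomial `z ^ w` at the points. -/
theorem maxDet_add_le (hM : ∀ z ∈ K, ∀ i, ‖z i‖ₑ ≤ M) {ι : Type*} [Fintype ι] [DecidableEq ι]
    (a : ι → Fin d → ℕ) (w : Fin d → ℕ) :
    maxDet K (fun i => a i + w) ≤ (M : ℝ≥0∞) ^ (Fintype.card ι * ∑ i, w i) * maxDet K a := by
  refine iSup₂_le fun ζ hζ => ?_
  have h : (Matrix.of fun α β => monom (a α + w) (ζ β)) =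
      Matrix.of fun α β => monom w (ζ β) * (Matrix.of fun α β => monom (a α) (ζ β)) α β := by
    ext α β
    simp [monom, pow_add, Finset.prod_mul_distrib, mul_comm]
  rw [h, Matrix.det_mul_row, enorm_mul]
  refine mul_le_mul' ?_ (le_iSup₂ (f := fun (ξ : ι → Fin d → ℂ) (_ : ∀ β, ξ β ∈ K) =>
      ‖(Matrix.of fun α β => monom (a α) (ξ β)).det‖ₑ) ζ hζ)
  rw [enorm_eq_nnnorm, nnnorm_prod, ENNReal.ofNNReal_finsetProd]
  refine (Finset.prod_le_prod' fun i _ => enorm_monom_le hM (hζ i) w).trans (le_of_eq ?_)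
  rw [Finset.prod_const, Finset.card_univ, ← pow_mul, mul_comm]

theorem finsetDet_image_add_le (hM : ∀ z ∈ K, ∀ i, ‖z i‖ₑ ≤ M) (S : Finset (Fin d → ℕ))
    (w : Fin d → ℕ) :
    finsetDet K (S.map (addRightEmbedding w)) ≤
      (M : ℝ≥0∞) ^ (S.card * ∑ i, w i) * finsetDet K S := by
  have h := maxDet_add_le hM (Subtype.val : S → Fin d → ℕ) w
  rw [Fintype.card_coe] at h
  refine le_trans (le_of_eq ?_) h
  exact (maxDet_comp_equiv (S.equivMap (addRightEmbedding w)) _).symm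

/-- If the exponents of `A` at level `m` translate into those of `B` at level `n`, the Vandermonde
maximum of `B` is controlled by that of `A`. The powers of `M` coming from the translation are
absorbed by the change of total degree. -/
theorem maxVandermonde_mul_pow_le (hM : ∀ z ∈ K, ∀ i, ‖z i‖ₑ ≤ M)
    {A B : ConvexBody (EuclideanSpace ℝ (Fin d))} {m n : ℕ} {w : Fin d → ℕ}
    (h : ∀ α ∈ exponents A m, α + w ∈ exponents B n) :
    maxVandermonde B K n * (M : ℝ≥0∞) ^ sumDegrees A m ≤
      ((exponents B n).card.factorial : ℕ) * (M : ℝ≥0∞) ^ sumDegrees B n *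
        maxVandermonde A K m := by
  set S := (exponents A m).map (addRightEmbedding w) with hS
  have hST : S ⊆ exponents B n := by
    intro x hx
    obtain ⟨α, hα, rfl⟩ := Finset.mem_map.1 hx
    exact h α hα
  have hsum : ∑ α ∈ S, ∑ i, α i = sumDegrees A m + (exponents A m).card * ∑ i, w i := by
    simp [hS, sumDegrees, Finset.sum_add_distrib]
  have hB : sumDegrees B n = ∑ α ∈ exponents B n \ S, ∑ i, α i +
      (sumDegrees A m + (exponents A m).card * ∑ i, w i) := by
    rw [← hsum, Finset.sum_sdiff hST, sumDegrees]
  have h1 := (finsetDet_le_of_subset hM hST).trans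
    (mul_le_mul_right (finsetDet_image_add_le hM (exponents A m) w) _)
  rw [maxVandermonde_eq, maxVandermonde_eq]
  refine (mul_le_mul_left h1 _).trans (le_of_eq ?_)
  rw [hB, pow_add, pow_add]
  ring

theorem sumDegrees_le_of_translate {A B : ConvexBody (EuclideanSpace ℝ (Fin d))} {m n : ℕ}
    {w : Fin d → ℕ} (h : ∀ α ∈ exponents A m, α + w ∈ exponents B n) :
    sumDegrees A m ≤ sumDegrees B n := by
  have hST : (exponents A m).map (addRightEmbedding w) ⊆ exponents B n := by
    intro x hx
    obtain ⟨α, hα, rfl⟩ := Finset.mem_map.1 hx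
    exact h α hα
  refine le_trans ?_ (Finset.sum_le_sum_of_subset (f := fun α : Fin d → ℕ => ∑ i, α i) hST)
  simp [sumDegrees, Finset.sum_add_distrib]

theorem maxVandermonde_le (hM : ∀ z ∈ K, ∀ i, ‖z i‖ₑ ≤ M)
    (B : ConvexBody (EuclideanSpace ℝ (Fin d))) (n : ℕ) :
    maxVandermonde B K n ≤
      ((exponents B n).card.factorial : ℕ) * (M : ℝ≥0∞) ^ sumDegrees B n := by
  have h := finsetDet_le_of_subset hM (Finset.empty_subset (exponents B n))
  rw [Finset.sdiff_empty] at h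
  exact h.trans (mul_le_of_le_one_right' finsetDet_empty_le)

end CTransfinite

/-! ### Counting exponents: asymptotics of `d_n` and `l_n` -/

namespace CTransfinite

variable {d : ℕ}

theorem mem_exponents {C : ConvexBody (EuclideanSpace ℝ (Fin d))} {n : ℕ} {α : Fin d → ℕ} :
    α ∈ exponents C n ↔ toPoint α ∈ (n : ℝ) • (C : Set (EuclideanSpace ℝ (Fin d))) := by
  simp [exponents]

namespace AdmissibleBody

theorem zero_mem (C : AdmissibleBody d) : (0 : EuclideanSpace ℝ (Fin d)) ∈ C.1 := by
  obtain ⟨ε, δ, hε, hδ, h1, h2⟩ := C.2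
  refine h1 ⟨0, ⟨fun i => by simp, by simp⟩, by simp⟩

theorem nonneg (C : AdmissibleBody d) {x : EuclideanSpace ℝ (Fin d)} (hx : x ∈ C.1) (i : Fin d) :
    0 ≤ x i := by
  obtain ⟨ε, δ, hε, hδ, h1, h2⟩ := C.2
  obtain ⟨y, hy, rfl⟩ := h2 hx
  exact mul_nonneg (hε.trans hδ).le (hy.1 i).1

/-- An admissible body has interior points: a small ball inside `εΣ`. -/
theorem exists_ball_subset (C : AdmissibleBody d) :
    ∃ v : EuclideanSpace ℝ (Fin d), ∃ r > 0, Metric.ball v r ⊆ (C.1 : Set _) := by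
  obtain ⟨ε, δ, hε, hδ, h1, h2⟩ := C.2
  have hd : (0 : ℝ) < d + 1 := by positivity
  set s : ℝ := ε / (2 * (d + 1)) with hs
  have hs0 : 0 < s := by positivity
  refine ⟨WithLp.toLp 2 fun _ => s, s, hs0, fun x hx => h1 ?_⟩
  have hxi : ∀ i, |x i - s| < s := fun i => by
    rw [mem_ball_iff_norm] at hx
    exact (PiLp.norm_apply_le (x - WithLp.toLp 2 fun _ => s) i).trans_lt hx
  have h0 : ∀ i, 0 ≤ x i := fun i => by linarith [(abs_lt.1 (hxi i)).1]
  have h2s : ∀ i, x i ≤ 2 * s := fun i => by linarith [(abs_lt.1 (hxi i)).2]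
  have hsum : ∑ i, x i ≤ ε := by
    calc ∑ i, x i ≤ ∑ _i : Fin d, 2 * s := Finset.sum_le_sum fun i _ => h2s i
      _ = ε * (d / (d + 1)) := by rw [hs]; simp; field_simp
      _ ≤ ε * 1 := by gcongr; rw [div_le_one hd]; linarith
      _ = ε := mul_one ε
  rw [Set.mem_smul_set_iff_inv_smul_mem₀ hε.ne']
  have hsum' : ∑ j, (ε⁻¹ • x) j ≤ 1 := by
    simp only [PiLp.smul_apply, smul_eq_mul]
    rw [← Finset.mul_sum, inv_mul_le_iff₀ hε, mul_one]
    exact hsum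
  have h0' : ∀ i, 0 ≤ (ε⁻¹ • x) i := fun i => mul_nonneg (inv_pos.2 hε).le (h0 i)
  exact ⟨fun i => ⟨h0' i, (Finset.single_le_sum (fun j _ => h0' j) (Finset.mem_univ i)).trans
    hsum'⟩, hsum'⟩

/-- The body `C` in the model `Fin d → ℝ` of `ℝ^d`. -/
def carrier (C : AdmissibleBody d) : Set (Fin d → ℝ) :=
  WithLp.toLp 2 ⁻¹' (C.1 : Set (EuclideanSpace ℝ (Fin d)))

theorem isCompact_carrier (C : AdmissibleBody d) : IsCompact C.carrier :=
  (PiLp.homeomorph 2 fun _ : Fin d => ℝ).symm.isCompact_preimage.2 C.1.isCompact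

theorem convex_carrier (C : AdmissibleBody d) : Convex ℝ C.carrier :=
  C.1.convex.linear_preimage (WithLp.linearEquiv 2 ℝ (Fin d → ℝ)).symm.toLinearMap

theorem exists_isOpen_subset_carrier (C : AdmissibleBody d) :
    ∃ U ⊆ C.carrier, IsOpen U ∧ U.Nonempty := by
  obtain ⟨v, r, hr, h⟩ := C.exists_ball_subset
  exact ⟨WithLp.toLp 2 ⁻¹' Metric.ball v r, Set.preimage_mono h,
    Metric.isOpen_ball.preimage (PiLp.continuous_toLp 2 _), ⟨WithLp.ofLp v, by simpa using hr⟩⟩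

/-- Riemann sums over the exponents converge to integrals over the body. -/
theorem tendsto_sum_exponents (C : AdmissibleBody d) {F : (Fin d → ℝ) → ℝ} (hF : Continuous F) :
    Tendsto (fun n : ℕ => (∑ α ∈ exponents C.1 n, F fun i => α i / n) / (n : ℝ) ^ d) atTop
      (𝓝 (∫ x in C.carrier, F x)) := by
  have h := tendsto_tsum_div_pow_atTop_integral C.carrier F hF C.isCompact_carrier.isBounded
    C.isCompact_carrier.measurableSet (C.convex_carrier.addHaar_frontier MeasureTheory.volume)
  refine h.congr' ?_
  filter_upwards [eventually_gt_atTop 0] with n hn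
  have : NeZero n := ⟨hn.ne'⟩
  have hn' : (n : ℝ) ≠ 0 := by exact_mod_cast hn.ne'
  classical
  rw [Fintype.card_fin]
  congr 1
  have hset : C.carrier ∩ ((n : ℝ)⁻¹ •
      (Submodule.span ℤ (Set.range (Pi.basisFun ℝ (Fin d))) : Submodule ℤ (Fin d → ℝ)) :
        Submodule ℤ (Fin d → ℝ)) =
      ((exponents C.1 n).image fun α i => (α i : ℝ) / n : Finset (Fin d → ℝ)) := by
    ext x
    simp only [Set.mem_inter_iff, SetLike.mem_coe, Finset.coe_image, Set.mem_image]
    rw [BoxIntegral.unitPartition.mem_smul_span_iff]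
    constructor
    · rintro ⟨hx, hz⟩
      choose z hz using hz
      have hz0 : ∀ i, 0 ≤ z i := fun i => by
        have h1 : (0 : ℝ) ≤ n * x i := mul_nonneg (Nat.cast_nonneg _) (C.nonneg hx i)
        rw [← hz i, eq_intCast] at h1
        exact_mod_cast h1
      have hz' : ∀ i, ((z i).toNat : ℝ) = n * x i := fun i => by
        rw [← hz i, eq_intCast, ← Int.cast_natCast, Int.toNat_of_nonneg (hz0 i)]
      refine ⟨fun i => (z i).toNat, ?_, ?_⟩
      · rw [mem_exponents]
        refine ⟨WithLp.toLp 2 x, hx, ?_⟩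
        ext i
        simp [toPoint, hz']
      · ext i
        rw [hz']
        field_simp
    · rintro ⟨α, hα, rfl⟩
      refine ⟨?_, fun i => ⟨α i, by simp; field_simp⟩⟩
      rw [mem_exponents] at hα
      obtain ⟨y, hy, hya⟩ := hα
      have : y = WithLp.toLp 2 fun i => (α i : ℝ) / n := by
        ext i
        have := congrArg (fun p : EuclideanSpace ℝ (Fin d) => p i) hya
        simp only [toPoint, PiLp.smul_apply, smul_eq_mul] at this
        simp [← this]
        field_simp
      change WithLp.toLp 2 _ ∈ C.1
      rw [← this]
      exact hy
  have hinj : Set.InjOn (fun (α : Fin d → ℕ) i => (α i : ℝ) / n) (exponents C.1 n) := by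
    intro α _ β _ hab
    ext i
    have := congrFun hab i
    simp only [div_left_inj' hn'] at this
    exact_mod_cast this
  rw [← Finset.sum_image (f := F) hinj, ← Finset.tsum_subtype]
  exact tsum_congr_set_coe F hset

/-- The moment `∫_C (x_1 + ⋯ + x_d) dx`, the leading coefficient of `sumDegrees`. -/
def moment (C : AdmissibleBody d) : ℝ := ∫ x in C.carrier, ∑ i, x i

theorem tendsto_card_div_pow (C : AdmissibleBody d) :
    Tendsto (fun n : ℕ => ((exponents C.1 n).card : ℝ) / (n : ℝ) ^ d) atTop
      (𝓝 (MeasureTheory.volume.real C.carrier)) := by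
  simpa using C.tendsto_sum_exponents (F := fun _ => 1) continuous_const

theorem tendsto_sumDegrees_div_pow (C : AdmissibleBody d) :
    Tendsto (fun n : ℕ => (sumDegrees C.1 n : ℝ) / (n : ℝ) ^ (d + 1)) atTop (𝓝 C.moment) := by
  refine (C.tendsto_sum_exponents (F := fun x => ∑ i, x i) (by fun_prop)).congr fun n => ?_
  simp only [sumDegrees, Nat.cast_sum, pow_succ, ← Finset.sum_div]
  rw [div_div, mul_comm]

theorem volume_carrier_pos (C : AdmissibleBody d) :
    0 < MeasureTheory.volume.real C.carrier := by
  obtain ⟨U, hU, hUo, hne⟩ := C.exists_isOpen_subset_carrier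
  refine ENNReal.toReal_pos ?_ C.isCompact_carrier.measure_lt_top.ne
  exact ((hUo.measure_pos _ hne).trans_le (MeasureTheory.measure_mono hU)).ne'

theorem moment_pos (hd : d ≠ 0) (C : AdmissibleBody d) : 0 < C.moment := by
  have : NeZero d := ⟨hd⟩
  have hcont : Continuous fun x : Fin d → ℝ => ∑ i, x i := by fun_prop
  have hnn : ∀ x ∈ C.carrier, 0 ≤ ∑ i, x i := fun x hx =>
    Finset.sum_nonneg fun i _ => C.nonneg hx i
  rw [moment, MeasureTheory.setIntegral_pos_iff_support_of_nonneg_ae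
    ((MeasureTheory.ae_restrict_mem C.isCompact_carrier.measurableSet).mono hnn)
    (hcont.continuousOn.integrableOn_compact C.isCompact_carrier)]
  obtain ⟨U, hU, hUo, x, hx⟩ := C.exists_isOpen_subset_carrier
  -- The sum of the coordinates is nonconstant along diagonal segments, so it cannot vanish
  -- identically on the nonempty open set `U`.
  have hsupp : (Function.support fun x : Fin d → ℝ => ∑ i, x i) ∩ U ≠ ∅ := by
    intro hempty
    have hev : ∀ᶠ t : ℝ in 𝓝 0, x + (fun _ => t) ∈ U := by
      have : Tendsto (fun t : ℝ => x + (fun _ : Fin d => t)) (𝓝 0) (𝓝 (x + fun _ => 0)) :=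
        Continuous.tendsto (by fun_prop) 0
      refine this.eventually (hUo.mem_nhds ?_)
      have h0 : (x + fun _ : Fin d => (0 : ℝ)) = x := add_zero x
      rwa [h0]
    have hzero : ∀ᶠ t : ℝ in 𝓝 0, (∑ i, x i) + d * t = 0 := by
      filter_upwards [hev] with t ht
      by_contra hne
      have : (x + fun _ => t) ∈ (Function.support fun x : Fin d → ℝ => ∑ i, x i) ∩ U := by
        refine ⟨?_, ht⟩
        simpa [Finset.sum_add_distrib] using hne
      rw [hempty] at this
      exact this
    have h0 := hzero.self_of_nhds
    obtain ⟨t, ht, ht0⟩ := ((hzero.filter_mono nhdsWithin_le_nhds).and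
      (self_mem_nhdsWithin : Set.Ioi (0 : ℝ) ∈ 𝓝[>] 0)).exists
    have : (0 : ℝ) < d * t := mul_pos (by exact_mod_cast Nat.pos_of_ne_zero hd) ht0
    linarith
  refine lt_of_lt_of_le ((((hcont.isOpen_support).inter hUo).measure_pos MeasureTheory.volume
    (Set.nonempty_iff_ne_empty.2 hsupp))) (MeasureTheory.measure_mono ?_)
  exact Set.inter_subset_inter_right _ hU

theorem tendsto_sumDegrees_atTop (hd : d ≠ 0) (C : AdmissibleBody d) :
    Tendsto (fun n : ℕ => (sumDegrees C.1 n : ℝ)) atTop atTop := by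
  have hp : Tendsto (fun n : ℕ => (n : ℝ) ^ (d + 1)) atTop atTop :=
    (tendsto_pow_atTop (by simp)).comp tendsto_natCast_atTop_atTop
  refine (C.tendsto_sumDegrees_div_pow.pos_mul_atTop (C.moment_pos hd) hp).congr' ?_
  filter_upwards [eventually_gt_atTop 0] with n hn
  have : (n : ℝ) ≠ 0 := by exact_mod_cast hn.ne'
  field_simp

/-- `l_{u(n)} / l_{v(n)} → c ^ (d + 1)` whenever `u(n) / v(n) → c`. -/
theorem tendsto_sumDegrees_div (hd : d ≠ 0) (C : AdmissibleBody d) {u v : ℕ → ℕ} {c : ℝ}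
    (hu : Tendsto u atTop atTop) (hv : Tendsto v atTop atTop)
    (huv : Tendsto (fun n => (u n : ℝ) / v n) atTop (𝓝 c)) :
    Tendsto (fun n => (sumDegrees C.1 (u n) : ℝ) / sumDegrees C.1 (v n)) atTop
      (𝓝 (c ^ (d + 1))) := by
  have h := ((C.tendsto_sumDegrees_div_pow.comp hu).div (C.tendsto_sumDegrees_div_pow.comp hv)
    (C.moment_pos hd).ne').mul (huv.pow (d + 1))
  rw [div_self (C.moment_pos hd).ne', one_mul] at h
  refine h.congr' ?_
  filter_upwards [hu.eventually_gt_atTop 0, hv.eventually_gt_atTop 0] with n h1 h2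
  have h1' : (u n : ℝ) ≠ 0 := by exact_mod_cast h1.ne'
  have h2' : (v n : ℝ) ≠ 0 := by exact_mod_cast h2.ne'
  simp only [Pi.div_apply, Function.comp_apply, div_pow]
  field_simp

/-- The factorials `d_n !` are negligible: `log (d_n !)` is `O(n ^ d * log n)`, whereas `l_n` grows
like `n ^ (d + 1)`. -/
theorem tendsto_factorial_rpow (hd : d ≠ 0) (C : AdmissibleBody d) :
    Tendsto (fun n : ℕ => ((exponents C.1 n).card.factorial : ℝ≥0∞) ^
      (1 / (sumDegrees C.1 n : ℝ))) atTop (𝓝 1) := by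
  set N : ℕ → ℝ := fun n => ((exponents C.1 n).card : ℝ) with hN
  have hcard := C.tendsto_card_div_pow
  have hvol := C.volume_carrier_pos
  have hlogn : Tendsto (fun n : ℕ => Real.log n / n) atTop (𝓝 0) :=
    (Real.isLittleO_log_id_atTop.tendsto_div_nhds_zero).comp tendsto_natCast_atTop_atTop
  have hlogN : Tendsto (fun n => Real.log (N n) / n) atTop (𝓝 0) := by
    have h1 : Tendsto (fun n : ℕ => Real.log (N n / (n : ℝ) ^ d) / n) atTop (𝓝 0) :=
      (hcard.log hvol.ne').div_atTop tendsto_natCast_atTop_atTop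
    have h2 := h1.add (hlogn.const_mul (d : ℝ))
    simp only [mul_zero, add_zero] at h2
    refine h2.congr' ?_
    filter_upwards [eventually_gt_atTop 0, hcard.eventually_ne hvol.ne'] with n hn hne
    have hn' : (n : ℝ) ≠ 0 := by exact_mod_cast hn.ne'
    have hNn : N n ≠ 0 := fun h => hne (by simp only [hN] at h; simp [h])
    rw [Real.log_div hNn (pow_ne_zero _ hn'), Real.log_pow]
    ring
  have hlim : Tendsto (fun n => (N n / (n : ℝ) ^ d) * (Real.log (N n) / n) /
      ((sumDegrees C.1 n : ℝ) / (n : ℝ) ^ (d + 1))) atTop (𝓝 0) := by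
    have h := (hcard.mul hlogN).div C.tendsto_sumDegrees_div_pow (C.moment_pos hd).ne'
    rwa [mul_zero, zero_div] at h
  have hfac : Tendsto (fun n : ℕ => Real.log ((exponents C.1 n).card.factorial : ℝ) *
      (1 / (sumDegrees C.1 n : ℝ))) atTop (𝓝 0) := by
    refine tendsto_of_tendsto_of_tendsto_of_le_of_le' tendsto_const_nhds hlim ?_ ?_
    · refine Eventually.of_forall fun n => mul_nonneg (Real.log_natCast_nonneg _) (by positivity)
    · filter_upwards [eventually_gt_atTop 0] with n hn
      have hn' : (n : ℝ) ≠ 0 := by exact_mod_cast hn.ne'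
      have hle : Real.log ((exponents C.1 n).card.factorial : ℝ) ≤ N n * Real.log (N n) := by
        rw [← Real.log_pow]
        refine Real.log_le_log (by exact_mod_cast Nat.factorial_pos _) ?_
        simp only [hN]
        exact_mod_cast Nat.factorial_le_pow _
      calc _ ≤ N n * Real.log (N n) * (1 / (sumDegrees C.1 n : ℝ)) := by gcongr
        _ = _ := by rw [pow_succ]; field_simp
  have hexp := ENNReal.tendsto_ofReal ((Real.continuous_exp.tendsto 0).comp hfac)
  rw [Real.exp_zero, ENNReal.ofReal_one] at hexp
  refine hexp.congr fun n => ?_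
  have hpos : (0 : ℝ) < ((exponents C.1 n).card.factorial : ℝ) := by
    exact_mod_cast Nat.factorial_pos _
  rw [Function.comp_apply, ← Real.rpow_def_of_pos hpos, ← ENNReal.ofReal_rpow_of_pos hpos,
    ENNReal.ofReal_natCast]

end AdmissibleBody

end CTransfinite

/-! ### Hausdorff-close bodies and translated dilates -/

namespace CTransfinite

variable {d : ℕ}

/-- A translate of `t • A` by a vector with nonnegative coordinates lies in `B`, together with a
neighbourhood of fixed radius. -/
def Absorbs (t : ℝ) (A B : ConvexBody (EuclideanSpace ℝ (Fin d))) : Prop :=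
  ∃ v : EuclideanSpace ℝ (Fin d), ∃ r > 0, (∀ i, 0 ≤ v i) ∧
    ∀ a ∈ A, ∀ x ∈ Metric.ball v r, t • a + x ∈ B

/-- If every point within `τ` of `y` is within distance less than `τ` of the convex body `C`, then
`y ∈ C`: otherwise move `y` by `τ` away from its nearest point in `C`. -/
theorem mem_of_closedBall_subset_thickening {E : Type*} [NormedAddCommGroup E]
    [InnerProductSpace ℝ E] (C : ConvexBody E) {y : E} {τ : ℝ} (hτ : 0 < τ)
    (h : ∀ z ∈ Metric.closedBall y τ, ∃ c ∈ C, dist z c < τ) : y ∈ C := by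
  obtain ⟨p, hp, hmin⟩ := exists_norm_eq_iInf_of_complete_convex C.nonempty
    C.isCompact.isComplete C.convex y
  rw [norm_eq_iInf_iff_real_inner_le_zero C.convex hp] at hmin
  by_contra hy
  have hne : y - p ≠ 0 := fun h0 => hy (by rw [sub_eq_zero.1 h0]; exact hp)
  have hn : 0 < ‖y - p‖ := norm_pos_iff.2 hne
  obtain ⟨c, hc, hdist⟩ := h (y + (τ / ‖y - p‖) • (y - p)) (by
    rw [mem_closedBall_iff_norm, add_sub_cancel_left, norm_smul, Real.norm_of_nonneg (by positivity),
      div_mul_cancel₀ _ hn.ne'])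
  have h1 := hmin c hc
  have h2 : inner ℝ (y - p) (y + (τ / ‖y - p‖) • (y - p) - c) =
      ‖y - p‖ ^ 2 + τ * ‖y - p‖ - inner ℝ (y - p) (c - p) := by
    have : y + (τ / ‖y - p‖) • (y - p) - c =
        (y - p) + (τ / ‖y - p‖) • (y - p) - (c - p) := by abel
    rw [this, inner_sub_right, inner_add_right, real_inner_smul_right,
      real_inner_self_eq_norm_sq]
    field_simp
  have h3 := real_inner_le_norm (y - p) (y + (τ / ‖y - p‖) • (y - p) - c)
  rw [dist_eq_norm] at hdist
  nlinarith [mul_lt_mul_of_pos_left hdist hn]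

/-- Hausdorff-close admissible bodies absorb each other up to a factor `t < 1`. Since the
origin lies on their boundaries, `t • C₀ ⊆ C` may fail without the translation. -/
theorem AdmissibleBody.eventually_absorbs (C₀ : AdmissibleBody d) {t : ℝ} (ht0 : 0 < t)
    (ht1 : t < 1) : ∀ᶠ C in 𝓝 C₀, Absorbs t C₀.1 C.1 ∧ Absorbs t C.1 C₀.1 := by
  obtain ⟨v₀, r₀, hr₀, hball⟩ := C₀.exists_ball_subset
  have hs : 0 < 1 - t := by linarith
  set τ : ℝ := (1 - t) * r₀ / 2 with hτdef
  have hτ : 0 < τ := by positivity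
  have hv : ∀ i, 0 ≤ ((1 - t) • v₀) i := fun i =>
    mul_nonneg hs.le (C₀.nonneg (hball (Metric.mem_ball_self hr₀)) i)
  have hmem : ∀ a ∈ C₀.1, ∀ x ∈ Metric.ball ((1 - t) • v₀) (2 * τ), t • a + x ∈ C₀.1 := by
    intro a ha x hx
    have hx' : (1 - t)⁻¹ • x ∈ C₀.1 := by
      refine hball ?_
      have : (1 - t)⁻¹ • x - v₀ = (1 - t)⁻¹ • (x - (1 - t) • v₀) := by
        rw [smul_sub, inv_smul_smul₀ hs.ne']
      rw [mem_ball_iff_norm] at hx ⊢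
      rw [this, norm_smul, Real.norm_of_nonneg (inv_pos.2 hs).le, inv_mul_lt_iff₀ hs]
      linarith
    have h := C₀.1.convex ha hx' ht0.le hs.le (by ring)
    rwa [smul_inv_smul₀ hs.ne'] at h
  filter_upwards [Metric.ball_mem_nhds C₀ hτ] with C hC
  have hdist : Metric.hausdorffDist (C.1 : Set (EuclideanSpace ℝ (Fin d))) C₀.1 < τ := hC
  refine ⟨⟨(1 - t) • v₀, τ, hτ, hv, fun a ha x hx => ?_⟩,
    ⟨(1 - t) • v₀, τ, hτ, hv, fun a ha x hx => ?_⟩⟩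
  · refine mem_of_closedBall_subset_thickening C.1 hτ fun z hz => ?_
    have hz0 : z ∈ C₀.1 := by
      have h := hmem a ha (z - t • a) (by
        rw [mem_ball_iff_norm] at hx ⊢
        rw [mem_closedBall_iff_norm] at hz
        have : z - t • a - (1 - t) • v₀ = (z - (t • a + x)) + (x - (1 - t) • v₀) := by abel
        rw [this]
        linarith [norm_add_le (z - (t • a + x)) (x - (1 - t) • v₀)])
      rwa [add_sub_cancel] at h
    obtain ⟨c, hc, hcd⟩ := Metric.exists_dist_lt_of_hausdorffDist_lt' hz0 hdist
      ConvexBody.hausdorffEDist_ne_top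
    exact ⟨c, hc, by rwa [dist_comm]⟩
  · obtain ⟨a₀, ha₀, had⟩ := Metric.exists_dist_lt_of_hausdorffDist_lt ha hdist
      ConvexBody.hausdorffEDist_ne_top
    have h := hmem a₀ ha₀ (x + t • (a - a₀)) (by
      rw [mem_ball_iff_norm] at hx ⊢
      rw [dist_eq_norm] at had
      have : x + t • (a - a₀) - (1 - t) • v₀ = (x - (1 - t) • v₀) + t • (a - a₀) := by abel
      rw [this]
      have h1 := norm_add_le (x - (1 - t) • v₀) (t • (a - a₀))
      rw [norm_smul, Real.norm_of_nonneg ht0.le] at h1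
      nlinarith [norm_nonneg (a - a₀)])
    have he : t • a₀ + (x + t • (a - a₀)) = t • a + x := by rw [smul_sub]; abel
    rwa [he] at h

/-- Absorption passes to lattice points: the translation vector `n • v` is rounded down to an
integer vector, which the room of radius `r` allows for large `n`. -/
theorem Absorbs.eventually_translate {t : ℝ} {A B : AdmissibleBody d} (ht : 0 < t)
    (h : Absorbs t A.1 B.1) : ∀ᶠ n : ℕ in atTop, ∀ m : ℕ, (m : ℝ) ≤ t * n →
      ∃ w : Fin d → ℕ, ∀ α ∈ exponents A.1 m, α + w ∈ exponents B.1 n := by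
  obtain ⟨v, r, hr, hv, h⟩ := h
  have hlim : Tendsto (fun n : ℕ => WithLp.toLp 2 fun i => ((⌊v i * n⌋₊ : ℕ) : ℝ) / n) atTop
      (𝓝 v) := by
    have : Tendsto (fun (n : ℕ) i => ((⌊v i * n⌋₊ : ℕ) : ℝ) / n) atTop (𝓝 (WithLp.ofLp v)) :=
      tendsto_pi_nhds.2 fun i =>
        (tendsto_nat_floor_mul_div_atTop (hv i)).comp tendsto_natCast_atTop_atTop
    exact ((PiLp.continuous_toLp 2 _).tendsto _).comp this
  filter_upwards [hlim.eventually (Metric.ball_mem_nhds v hr), eventually_gt_atTop 0]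
    with n hn hn0 m hm
  have hn' : (0 : ℝ) < n := by exact_mod_cast hn0
  refine ⟨fun i => ⌊v i * n⌋₊, fun α hα => ?_⟩
  rw [mem_exponents] at hα ⊢
  obtain ⟨a, ha, haα⟩ := hα
  have ha' : ((m : ℝ) / (t * n)) • a ∈ A.1 := by
    have hle : (m : ℝ) / (t * n) ≤ 1 := (div_le_one (by positivity)).2 hm
    have := A.1.convex ha A.zero_mem (by positivity : 0 ≤ (m : ℝ) / (t * n))
      (sub_nonneg.2 hle) (by ring)
    simpa using this
  refine ⟨_, h _ ha' _ hn, ?_⟩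
  ext i
  have hi := congrArg (fun p : EuclideanSpace ℝ (Fin d) => p i) haα
  simp only [toPoint, PiLp.smul_apply, smul_eq_mul] at hi
  simp only [toPoint, PiLp.smul_apply, PiLp.add_apply, smul_eq_mul, Pi.add_apply, Nat.cast_add,
    ← hi]
  field_simp

end CTransfinite

/-! ### Comparison of transfinite diameters and continuity -/

namespace CTransfinite

open scoped NNReal

variable {d : ℕ} {K : Set (Fin d → ℂ)} {M : ℝ≥0}

/-- The weighted geometric mean `M ^ (1 - ρ) * x ^ ρ`, written so that its monotonicity in `ρ` for
`x ≤ M` is visible. -/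
def weightedMean (M : ℝ≥0) (ρ : ℝ) (x : ℝ≥0∞) : ℝ≥0∞ := M * (x / M) ^ ρ

theorem tendsto_weightedMean (hM : 1 ≤ M) {x : ℝ≥0∞} (hx : x ≠ ⊤) :
    Tendsto (fun ρ : ℝ => weightedMean M ρ x) (𝓝 1) (𝓝 x) := by
  have hM0 : (M : ℝ≥0∞) ≠ 0 := by simpa using (zero_lt_one.trans_le hM).ne'
  lift x to ℝ≥0 using hx
  have h : Tendsto (fun ρ : ℝ => (x / M) ^ ρ) (𝓝 1) (𝓝 ((x / M) ^ (1 : ℝ))) :=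
    (NNReal.continuousAt_rpow (Or.inr one_pos)).tendsto.comp
      (tendsto_const_nhds.prodMk_nhds tendsto_id)
  rw [NNReal.rpow_one] at h
  have h2 := ENNReal.Tendsto.const_mul (a := (M : ℝ≥0∞)) (ENNReal.tendsto_coe.2 h)
    (Or.inr ENNReal.coe_ne_top)
  have hM0' : M ≠ 0 := by simpa using hM0
  rw [ENNReal.coe_div hM0', ENNReal.mul_div_cancel hM0 ENNReal.coe_ne_top] at h2
  refine h2.congr' ?_
  filter_upwards [lt_mem_nhds (zero_lt_one' ℝ)] with ρ hρ
  rw [weightedMean, ENNReal.coe_rpow_of_nonneg _ hρ.le, ENNReal.coe_div hM0']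

theorem weightedMean_mono {ρ : ℝ} (hρ : 0 ≤ ρ) : Monotone (weightedMean M ρ) := by
  intro x y hxy
  unfold weightedMean
  gcongr

theorem continuous_weightedMean (hM : 1 ≤ M) (ρ : ℝ) : Continuous (weightedMean M ρ) := by
  have hM0 : (M : ℝ≥0∞) ≠ 0 := by simpa using (zero_lt_one.trans_le hM).ne'
  exact (ENNReal.continuous_const_mul ENNReal.coe_ne_top).comp
    ((ENNReal.continuous_rpow_const).comp (ENNReal.continuous_div_const _ hM0))

theorem maxVandermonde_rpow_le (hM1 : 1 ≤ M) (hM : ∀ z ∈ K, ∀ i, ‖z i‖ₑ ≤ M)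
    {A B : ConvexBody (EuclideanSpace ℝ (Fin d))} {m n : ℕ} {w : Fin d → ℕ}
    (h : ∀ α ∈ exponents A m, α + w ∈ exponents B n) (hA : sumDegrees A m ≠ 0)
    (hB : sumDegrees B n ≠ 0) {x : ℝ≥0∞} (hxM : x ≤ M)
    (hx : maxVandermonde A K m ^ (1 / (sumDegrees A m : ℝ)) ≤ x) {ρ : ℝ}
    (hρ : ρ * sumDegrees B n ≤ sumDegrees A m) :
    maxVandermonde B K n ^ (1 / (sumDegrees B n : ℝ)) ≤
      ((exponents B n).card.factorial : ℝ≥0∞) ^ (1 / (sumDegrees B n : ℝ)) *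
        weightedMean M ρ x := by
  have hM0 : (M : ℝ≥0∞) ≠ 0 := by simpa using (zero_lt_one.trans_le hM1).ne'
  have hA' : (sumDegrees A m : ℝ) ≠ 0 := by exact_mod_cast hA
  have hB' : (sumDegrees B n : ℝ) ≠ 0 := by exact_mod_cast hB
  set lA := sumDegrees A m
  set lB := sumDegrees B n
  set D : ℝ≥0∞ := ((exponents B n).card.factorial : ℝ≥0∞)
  have hVA : maxVandermonde A K m ≤ x ^ lA := by
    have := ENNReal.rpow_le_rpow hx (Nat.cast_nonneg lA)
    rwa [← ENNReal.rpow_mul, one_div_mul_cancel hA', ENNReal.rpow_one,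
      ENNReal.rpow_natCast] at this
  have hxM1 : x / M ≤ 1 := ENNReal.div_le_of_le_mul (by rwa [one_mul])
  have hVB : maxVandermonde B K n ≤ D * (M : ℝ≥0∞) ^ lB * (x / M) ^ (ρ * lB) := by
    calc maxVandermonde B K n
        ≤ D * (M : ℝ≥0∞) ^ lB * x ^ lA / (M : ℝ≥0∞) ^ lA := by
          rw [ENNReal.le_div_iff_mul_le (Or.inl (pow_ne_zero _ hM0))
            (Or.inl (ENNReal.pow_ne_top ENNReal.coe_ne_top))]
          exact (maxVandermonde_mul_pow_le hM h).trans (mul_le_mul_right hVA _)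
      _ = D * (M : ℝ≥0∞) ^ lB * (x / M) ^ (lA : ℝ) := by
          rw [ENNReal.rpow_natCast, div_eq_mul_inv x, mul_pow, ← ENNReal.inv_pow, mul_div_assoc,
            div_eq_mul_inv]
      _ ≤ _ := by
          exact mul_le_mul_right (ENNReal.rpow_le_rpow_of_exponent_ge hxM1 hρ) _
  have hpos : (0 : ℝ) ≤ 1 / lB := by positivity
  refine (ENNReal.rpow_le_rpow hVB hpos).trans (le_of_eq ?_)
  rw [ENNReal.mul_rpow_of_nonneg _ _ hpos, ENNReal.mul_rpow_of_nonneg _ _ hpos,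
    ← ENNReal.rpow_mul, mul_assoc ρ, mul_one_div_cancel hB', mul_one, ← ENNReal.rpow_natCast, ← ENNReal.rpow_mul,
    mul_one_div_cancel hB', ENNReal.rpow_one, weightedMean, mul_assoc]

namespace AdmissibleBody

theorem eventually_sumDegrees_ne_zero (hd : d ≠ 0) (C : AdmissibleBody d) :
    ∀ᶠ n in atTop, sumDegrees C.1 n ≠ 0 := by
  filter_upwards [(C.tendsto_sumDegrees_atTop hd).eventually_gt_atTop 0] with n hn
  exact_mod_cast hn.ne'

theorem transfiniteDiameter_le_bound (hd : d ≠ 0) (hM : ∀ z ∈ K, ∀ i, ‖z i‖ₑ ≤ M)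
    (C : AdmissibleBody d) : transfiniteDiameter C.1 K ≤ M := by
  have h := ENNReal.Tendsto.mul_const (b := (M : ℝ≥0∞)) (C.tendsto_factorial_rpow hd)
    (Or.inr ENNReal.coe_ne_top)
  rw [one_mul] at h
  rw [← h.limsup_eq]
  refine limsup_le_limsup ?_
  filter_upwards [C.eventually_sumDegrees_ne_zero hd] with n hn
  have hn' : (sumDegrees C.1 n : ℝ) ≠ 0 := by exact_mod_cast hn
  have hpos : (0 : ℝ) ≤ 1 / sumDegrees C.1 n := by positivity
  refine (ENNReal.rpow_le_rpow (maxVandermonde_le hM C.1 n) hpos).trans (le_of_eq ?_)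
  rw [ENNReal.mul_rpow_of_nonneg _ _ hpos, ← ENNReal.rpow_natCast, ← ENNReal.rpow_mul,
    mul_one_div_cancel hn', ENNReal.rpow_one]

theorem transfiniteDiameter_le_weightedMean (hd : d ≠ 0) (hM1 : 1 ≤ M)
    (hM : ∀ z ∈ K, ∀ i, ‖z i‖ₑ ≤ M) {A B : AdmissibleBody d} {t ρ : ℝ} (ht : 0 < t)
    (hAB : Absorbs t A.1 B.1)
    (hρ : ∀ᶠ n : ℕ in atTop, ρ * sumDegrees B.1 n ≤ sumDegrees A.1 ⌊t * n⌋₊) :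
    transfiniteDiameter B.1 K ≤ weightedMean M ρ (transfiniteDiameter A.1 K) := by
  have hM0 : (M : ℝ≥0∞) ≠ 0 := by simpa using (zero_lt_one.trans_le hM1).ne'
  rcases (A.transfiniteDiameter_le_bound hd hM).eq_or_lt with heq | hlt
  · rw [heq, weightedMean, ENNReal.div_self hM0 ENNReal.coe_ne_top, ENNReal.one_rpow, mul_one]
    exact B.transfiniteDiameter_le_bound hd hM
  have hfloor : Tendsto (fun n : ℕ => ⌊t * n⌋₊) atTop atTop :=
    tendsto_nat_floor_atTop.comp (tendsto_natCast_atTop_atTop.const_mul_atTop ht)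
  have key : ∀ x, transfiniteDiameter A.1 K < x → x ≤ M →
      transfiniteDiameter B.1 K ≤ weightedMean M ρ x := by
    intro x hx hxM
    have hfin : weightedMean M ρ x ≠ ⊤ ∨ (1 : ℝ≥0∞) ≠ 0 := Or.inr one_ne_zero
    have h := ENNReal.Tendsto.mul_const (B.tendsto_factorial_rpow hd) hfin.symm
    rw [one_mul] at h
    rw [← h.limsup_eq]
    refine limsup_le_limsup ?_
    filter_upwards [hρ, hfloor.eventually (eventually_lt_of_limsup_lt hx),
      hfloor.eventually (A.eventually_sumDegrees_ne_zero hd), B.eventually_sumDegrees_ne_zero hd,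
      hAB.eventually_translate ht] with n h1 h2 h3 h4 h5
    obtain ⟨w, hw⟩ := h5 ⌊t * n⌋₊ (Nat.floor_le (by positivity))
    exact maxVandermonde_rpow_le hM1 hM hw h3 h4 hxM h2.le h1
  have : (𝓝[>] (transfiniteDiameter A.1 K)).NeBot := nhdsGT_neBot_of_exists_gt ⟨_, hlt⟩
  refine ge_of_tendsto (((continuous_weightedMean hM1 ρ).tendsto _).mono_left
    (nhdsWithin_le_nhds (s := Set.Ioi (transfiniteDiameter A.1 K)))) ?_
  filter_upwards [self_mem_nhdsWithin, Ioc_mem_nhdsGT hlt] with x hx hx'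
  exact key x hx hx'.2

/-- The two comparisons between a fixed body and its Hausdorff neighbours. The ratios of the
degrees `l_n` are estimated through the fixed body alone, by composing the two absorptions; they
tend to `t ^ (2 * (d + 1))`, so `t` is chosen close enough to `1` in terms of `ρ`. -/
theorem eventually_transfiniteDiameter_le (hd : d ≠ 0) (hM1 : 1 ≤ M)
    (hM : ∀ z ∈ K, ∀ i, ‖z i‖ₑ ≤ M) (C₀ : AdmissibleBody d) {ρ : ℝ} (hρ0 : 0 ≤ ρ) (hρ1 : ρ < 1) :
    ∀ᶠ C in 𝓝 C₀,
      transfiniteDiameter C.1 K ≤ weightedMean M ρ (transfiniteDiameter C₀.1 K) ∧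
      transfiniteDiameter C₀.1 K ≤ weightedMean M ρ (transfiniteDiameter C.1 K) := by
  obtain ⟨t, ht0, ht1, htρ⟩ : ∃ t : ℝ, 0 < t ∧ t < 1 ∧ ρ < (t * t) ^ (d + 1) := by
    have hcont : Tendsto (fun t : ℝ => (t * t) ^ (d + 1)) (𝓝[<] 1) (𝓝 ((1 * 1) ^ (d + 1))) :=
      ((by fun_prop : Continuous fun t : ℝ => (t * t) ^ (d + 1)).tendsto 1).mono_left
        nhdsWithin_le_nhds
    rw [one_mul, one_pow] at hcont
    obtain ⟨t, h1, h2⟩ := ((hcont.eventually (lt_mem_nhds hρ1)).and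
      (Ioo_mem_nhdsLT (zero_lt_one' ℝ))).exists
    exact ⟨t, h2.1, h2.2, h1⟩
  have hcast : Tendsto (fun n : ℕ => (n : ℝ)) atTop atTop := tendsto_natCast_atTop_atTop
  have hfloor : Tendsto (fun n : ℕ => ⌊t * n⌋₊) atTop atTop :=
    tendsto_nat_floor_atTop.comp (hcast.const_mul_atTop ht0)
  have hfloor' : Tendsto (fun n : ℕ => ((⌊t * n⌋₊ : ℕ) : ℝ) / n) atTop (𝓝 t) :=
    (tendsto_nat_floor_mul_div_atTop ht0.le).comp hcast
  have hceil : Tendsto (fun n : ℕ => ⌈t⁻¹ * n⌉₊) atTop atTop :=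
    tendsto_nat_ceil_atTop.comp (hcast.const_mul_atTop (inv_pos.2 ht0))
  have hceil' : Tendsto (fun n : ℕ => ((⌈t⁻¹ * n⌉₊ : ℕ) : ℝ) / n) atTop (𝓝 t⁻¹) :=
    (tendsto_nat_ceil_mul_div_atTop (inv_pos.2 ht0).le).comp hcast
  have hratio₁ : ∀ᶠ n : ℕ in atTop,
      ρ * sumDegrees C₀.1 n ≤ sumDegrees C₀.1 ⌊t * (⌊t * n⌋₊ : ℕ)⌋₊ := by
    have hlim : Tendsto (fun n : ℕ => ((⌊t * (⌊t * n⌋₊ : ℕ)⌋₊ : ℕ) : ℝ) / n) atTop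
        (𝓝 (t * t)) := by
      refine ((hfloor'.comp hfloor).mul hfloor').congr' ?_
      filter_upwards [hfloor.eventually_gt_atTop 0] with n hn
      have hn' : ((⌊t * n⌋₊ : ℕ) : ℝ) ≠ 0 := by exact_mod_cast hn.ne'
      simp only [Function.comp_apply]
      field_simp
    filter_upwards [(C₀.tendsto_sumDegrees_div hd (hfloor.comp hfloor) tendsto_id
      hlim).eventually (lt_mem_nhds htρ), C₀.eventually_sumDegrees_ne_zero hd] with n h1 h2
    have h2' : (0 : ℝ) < sumDegrees C₀.1 n := by exact_mod_cast Nat.pos_of_ne_zero h2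
    exact ((lt_div_iff₀ h2').1 h1).le
  have hratio₂ : ∀ᶠ n : ℕ in atTop,
      ρ * sumDegrees C₀.1 ⌈t⁻¹ * n⌉₊ ≤ sumDegrees C₀.1 ⌊t * n⌋₊ := by
    have hlim : Tendsto (fun n : ℕ => ((⌊t * n⌋₊ : ℕ) : ℝ) / (⌈t⁻¹ * n⌉₊ : ℕ)) atTop
        (𝓝 (t * t)) := by
      have h := hfloor'.div hceil' (inv_pos.2 ht0).ne'
      rw [div_inv_eq_mul] at h
      refine h.congr' ?_
      filter_upwards [eventually_gt_atTop 0] with n hn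
      have hn' : (n : ℝ) ≠ 0 := by exact_mod_cast hn.ne'
      exact div_div_div_cancel_right₀ hn' _ _
    filter_upwards [(C₀.tendsto_sumDegrees_div hd hfloor hceil hlim).eventually (lt_mem_nhds htρ),
      hceil.eventually (C₀.eventually_sumDegrees_ne_zero hd)] with n h1 h2
    have h2' : (0 : ℝ) < sumDegrees C₀.1 ⌈t⁻¹ * n⌉₊ := by exact_mod_cast Nat.pos_of_ne_zero h2
    exact ((lt_div_iff₀ h2').1 h1).le
  filter_upwards [C₀.eventually_absorbs ht0 ht1] with C ⟨h₀, h₁⟩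
  constructor
  · refine transfiniteDiameter_le_weightedMean hd hM1 hM ht0 h₀ ?_
    filter_upwards [hratio₂, hceil.eventually (h₁.eventually_translate ht0)] with n h2 h3
    obtain ⟨w, hw⟩ := h3 n (by
      have := Nat.le_ceil (t⁻¹ * (n : ℝ))
      rwa [inv_mul_le_iff₀ ht0] at this)
    refine le_trans ?_ h2
    gcongr
    exact sumDegrees_le_of_translate hw
  · refine transfiniteDiameter_le_weightedMean hd hM1 hM ht0 h₁ ?_
    filter_upwards [hratio₁, hfloor.eventually (h₀.eventually_translate ht0)] with n h2 h3
    obtain ⟨w, hw⟩ := h3 ⌊t * (⌊t * n⌋₊ : ℕ)⌋₊ (Nat.floor_le (by positivity))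
    exact h2.trans (by exact_mod_cast sumDegrees_le_of_translate hw)

theorem continuous_transfiniteDiameter (hd : d ≠ 0) (hM1 : 1 ≤ M)
    (hM : ∀ z ∈ K, ∀ i, ‖z i‖ₑ ≤ M) :
    Continuous fun C : AdmissibleBody d => transfiniteDiameter C.1 K := by
  have hmem : ∀ᶠ ρ : ℝ in 𝓝[<] 1, ρ ∈ Set.Ioo (0 : ℝ) 1 := Ioo_mem_nhdsLT zero_lt_one
  refine continuous_iff_continuousAt.2 fun C₀ => tendsto_order.2 ⟨fun y hy => ?_, fun y hy => ?_⟩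
  · have hlim := (tendsto_weightedMean hM1 hy.ne_top).mono_left
      (nhdsWithin_le_nhds (s := Set.Iio 1))
    obtain ⟨ρ, h1, h2⟩ := ((hlim.eventually (gt_mem_nhds hy)).and hmem).exists
    filter_upwards [C₀.eventually_transfiniteDiameter_le hd hM1 hM h2.1.le h2.2] with C hC
    by_contra! hle
    exact (hC.2.trans (weightedMean_mono h2.1.le hle)).not_gt h1
  · have hlim := (tendsto_weightedMean hM1 ((C₀.transfiniteDiameter_le_bound hd hM).trans_lt
      ENNReal.coe_lt_top).ne).mono_left (nhdsWithin_le_nhds (s := Set.Iio 1))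
    obtain ⟨ρ, h1, h2⟩ := ((hlim.eventually (gt_mem_nhds hy)).and hmem).exists
    filter_upwards [C₀.eventually_transfiniteDiameter_le hd hM1 hM h2.1.le h2.2] with C hC
    exact hC.1.trans_lt h1

end AdmissibleBody

theorem transfiniteDiameter_fin_zero (K : Set (Fin 0 → ℂ))
    (C : ConvexBody (EuclideanSpace ℝ (Fin 0))) : transfiniteDiameter C K = 1 := by
  simp [transfiniteDiameter, sumDegrees]

end CTransfinite

end

theorem proposition2p2 {d : ℕ} (K : Set (Fin d → ℂ)) (hK : IsCompact K) :
    (∀ C : CTransfinite.AdmissibleBody d, CTransfinite.transfiniteDiameter C.1 K < ⊤) ∧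
      Continuous (fun C : CTransfinite.AdmissibleBody d =>
        CTransfinite.transfiniteDiameter C.1 K) := by
  rcases eq_or_ne d 0 with rfl | hd
  · -- In dimension zero every exponent `1 / l_n` is `1 / 0 = 0`.
    simp only [CTransfinite.transfiniteDiameter_fin_zero]
    exact ⟨fun _ => ENNReal.one_lt_top, continuous_const⟩
  obtain ⟨r, hr⟩ := hK.isBounded.exists_norm_le
  have hM1 : 1 ≤ max 1 r.toNNReal := le_max_left _ _
  have hM : ∀ z ∈ K, ∀ i, ‖z i‖ₑ ≤ ((max 1 r.toNNReal : NNReal) : ℝ≥0∞) := by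
    intro z hz i
    rw [enorm_eq_nnnorm, ENNReal.coe_le_coe]
    refine le_max_of_le_right ?_
    rw [← norm_toNNReal]
    exact Real.toNNReal_le_toNNReal ((norm_le_pi_norm z i).trans (hr z hz))
  exact ⟨fun C => (C.transfiniteDiameter_le_bound hd hM).trans_lt ENNReal.coe_lt_top,
    CTransfinite.AdmissibleBody.continuous_transfiniteDiameter hd hM1 hM⟩
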